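/- Let $T(x)=x-\frac1x$ be the Boole map on $\mathbb R$ (defined Lebesgue-almost everywhere together with all its iterates), and let $m$ be Lebesgue measure. For a bounded measurable $G:\mathbb R\to\mathbb C$ write $\mathrm{avg}(G):=\lim_{a\to+\infty}\frac1{2a}\int_{-a}^a G\,dm$ whenever this limit exists. Let $F:\mathbb R\to\mathbb R$ be measurable and bounded, and suppose that $\mathrm{avg}(e^{i\theta F})$ exists for every $\theta\in\mathbb R$. Suppose also that $F$ is uniformly continuous at infinity, that is, for every $\varepsilon>0$ there are $\delta,Q>0$ such that $|F(x)-F(y)|\le\varepsilon$ for all $x,y\in\mathbb R\setminus(-Q,Q)$ with $|x-y|\le\delta$. For an integer $k\ge1$ put $\mathcal A_kF:=\frac1k\sum_{j=0}^{k-1}F\circ T^j$. We say that measurable functions $F_n:\mathbb R\to\mathbb R$ converge to a random variable $X$ in strong distributional sense if, for every probability measure $\nu\ll m$, the distribution of $F_n$ with respect to $\nu$ converges weakly to the distribution of $X$. Then there exists a real random variable $X$ with characteristic function $\varphi_X(\theta)=\mathrm{avg}(e^{i\theta F})$, $\theta\in\mathbb R$, and for any such $X$: (i) for every fixed $k\ge1$,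 $\mathcal A_kF\circ T^n$ converges to $X$ in strong distributional sense as $n\to\infty$; (ii) there exists a sequence $(k_n)$ of positive integers with $k_n\to\infty$ such that $\mathcal A_{k_n}F\circ T^n$ converges to $X$ in strong distributional sense as $n\to\infty$. -/

import Mathlib

open MeasureTheory Filter Topology

namespace BooleMap

/-- The Boole map `T x = x - 1 / x`. At the excluded point `x = 0` the value is `0`; the orbits
that ever reach `0` form a countable, hence Lebesgue-null, set. -/
noncomputable def boole (x : ℝ) : ℝ := x - 1 / x

/-- The infinite-volume average `lim_{a → +∞} (1 / 2a) ∫_{-a}^{a} G dm` exists and equals `L`. -/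
def HasAvg (G : ℝ → ℂ) (L : ℂ) : Prop :=
  Tendsto (fun a : ℝ => ((1 / (2 * a) : ℝ) : ℂ) * ∫ x in (-a)..a, G x) atTop (𝓝 L)

/-- The function `e^{iθF}`. -/
noncomputable def expObs (F : ℝ → ℝ) (θ : ℝ) (x : ℝ) : ℂ :=
  Complex.exp (Complex.I * θ * F x)

/-- Uniform continuity at infinity: `x` and `y` range over `ℝ \ (-Q, Q)`. -/
def UniformContinuousAtInfinity (F : ℝ → ℝ) : Prop :=
  ∀ ε : ℝ, 0 < ε → ∃ δ Q : ℝ, 0 < δ ∧ 0 < Q ∧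
    ∀ x y : ℝ, x ∉ Set.Ioo (-Q) Q → y ∉ Set.Ioo (-Q) Q → |x - y| ≤ δ → |F x - F y| ≤ ε

/-- `Fn n` converges to the random variable `X` in strong distributional sense: for every
probability measure `ν` absolutely continuous with respect to Lebesgue measure, the law of `Fn n`
under `ν` converges weakly to the law of `X` under `P`. -/
def TendstoStrongDistribution {Ω : Type*} [MeasurableSpace Ω] (Fn : ℕ → ℝ → ℝ) (X : Ω → ℝ)
    (P : Measure Ω) [IsProbabilityMeasure P] : Prop :=
  ∀ (ν : Measure ℝ) [IsProbabilityMeasure ν], ν ≪ (volume : Measure ℝ) →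
    TendstoInDistribution Fn atTop X (fun _ => ν) P

end BooleMap

/-! The map extends to the upper half-plane as `z ↦ z - 1/z` and sends the Cauchy law at `z` to the
Cauchy law at `z - 1/z` (`integral_cauchyKernel_comp_boole`). Along a half-plane orbit the imaginary
part tends to infinity while the real part stays bounded, so a Cauchy law evolves into very wide,
nearly centred Cauchy laws. A centred Cauchy law is a mixture of uniform laws on symmetric
intervals, so these wide laws integrate a bounded `G` to nearly `avg(G)`. Any `L¹` density is close
to its convolution with a narrow Cauchy law; hence `∫ G ∘ T^n dν → avg(G)` for every probability `ν
≪ m` (`HasAvg.tendsto_integral_comp_boole_iterate`).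

For `G = e^{iθF}` this is convergence of the characteristic functions of `F ∘ T^n`. The laws live on
one compact interval, so `X` exists, and `F ∘ T^n` converges to it. For `G` the indicator of a
compact set it says that mass escapes to infinity. There `T^j x - x → 0`, so uniform continuity at
infinity makes `A_k F - F` small, and `A_k F ∘ T^n - F ∘ T^n → 0` in probability; this gives (i).
For (ii), a diagonal sequence is chosen for one probability measure equivalent to `m`; every `ν ≪ m`
inherits the convergence. -/

namespace BooleMap

/-! ### Cauchy kernels and their affine changes of variable. -/

/-- The Poisson kernel of the upper half-plane at `a + b i`, that is, `π` times the density of the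
Cauchy distribution with location `a` and scale `b`. -/
noncomputable def cauchyKernel (a b t : ℝ) : ℝ := b / ((t - a) ^ 2 + b ^ 2)

/-- The action of `z ↦ z - 1 / z` on the upper half-plane, in real coordinates. -/
noncomputable def halfPlaneMap (z : ℝ × ℝ) : ℝ × ℝ :=
  (z.1 * (1 - 1 / (z.1 ^ 2 + z.2 ^ 2)), z.2 * (1 + 1 / (z.1 ^ 2 + z.2 ^ 2)))

lemma measurable_boole : Measurable boole := by
  unfold boole; fun_prop

lemma measurable_boole_iterate (n : ℕ) : Measurable boole^[n] := measurable_boole.iterate n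

lemma cauchyKernel_denom_pos {a b : ℝ} (hb : 0 < b) (t : ℝ) : 0 < (t - a) ^ 2 + b ^ 2 := by
  positivity

lemma continuous_cauchyKernel (a : ℝ) {b : ℝ} (hb : 0 < b) : Continuous (cauchyKernel a b) := by
  unfold cauchyKernel
  exact continuous_const.div (by fun_prop) fun t => (cauchyKernel_denom_pos hb t).ne'

lemma cauchyKernel_nonneg (a : ℝ) {b : ℝ} (hb : 0 < b) (t : ℝ) : 0 ≤ cauchyKernel a b t := by
  unfold cauchyKernel; positivity

lemma cauchyKernel_zero_one : cauchyKernel 0 1 = fun t => (1 + t ^ 2)⁻¹ := by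
  funext t; simp [cauchyKernel, add_comm]

lemma integrable_cauchyKernel_zero_one : Integrable (cauchyKernel 0 1) := by
  rw [cauchyKernel_zero_one]; exact integrable_inv_one_add_sq

lemma integral_cauchyKernel_zero_one : ∫ t, cauchyKernel 0 1 t = Real.pi := by
  rw [cauchyKernel_zero_one]; exact integral_univ_inv_one_add_sq

lemma cauchyKernel_affine (a c : ℝ) {b : ℝ} (hb : 0 < b) (u : ℝ) :
    b * cauchyKernel a b (c + b * u) = cauchyKernel ((a - c) / b) 1 u := by
  have h1 := cauchyKernel_denom_pos (a := a) hb (c + b * u)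
  have h2 := cauchyKernel_denom_pos (a := (a - c) / b) one_pos u
  unfold cauchyKernel
  rw [← mul_div_assoc, div_eq_div_iff h1.ne' h2.ne']
  field_simp
  ring

lemma integrable_cauchyKernel (a : ℝ) {b : ℝ} (hb : 0 < b) : Integrable (cauchyKernel a b) := by
  have h : (fun u => cauchyKernel a b u) =
      fun u => b⁻¹ * cauchyKernel 0 1 ((u - a) / b) := by
    funext u
    have := cauchyKernel_affine a a hb ((u - a) / b)
    rw [sub_self, zero_div] at this
    rw [← this]
    field_simp
    ring_nf
  change Integrable (fun u => cauchyKernel a b u)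
  rw [h]
  exact ((integrable_cauchyKernel_zero_one.comp_div hb.ne').comp_sub_right a).const_mul _

/-- The centre `c` is left free: `c = a` recentres the kernel completely, while `c = 0` only
rescales and leaves the ratio `a / b` as location. -/
lemma integral_smul_cauchyKernel (H : ℝ → ℂ) (a c : ℝ) {b : ℝ} (hb : 0 < b) :
    ∫ x, cauchyKernel a b x • H x = ∫ u, cauchyKernel ((a - c) / b) 1 u • H (c + b * u) := by
  have h1 := integral_add_left_eq_self (μ := volume) (fun x => cauchyKernel a b x • H x) c
  have h2 := Measure.integral_comp_mul_left (fun x => cauchyKernel a b (c + x) • H (c + x)) b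
  rw [h1, abs_of_pos (inv_pos.2 hb)] at h2
  rw [← inv_smul_eq_iff₀ (inv_ne_zero hb.ne'), inv_inv] at h2
  rw [← h2, ← integral_smul]
  refine integral_congr_ae (.of_forall fun u => ?_)
  simp only
  rw [← cauchyKernel_affine a c hb u, smul_smul]

lemma integrable_smul_of_bounded {α : Type*} [MeasurableSpace α] {μ : Measure α} {k : α → ℝ}
    (hk : Integrable k μ) {H : α → ℂ} (hH : Measurable H) {M : ℝ} (hM : ∀ x, ‖H x‖ ≤ M) :
    Integrable (fun x => k x • H x) μ := by
  refine (hk.norm.mul_const M).mono' (hk.aestronglyMeasurable.smul hH.aestronglyMeasurable)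
    (.of_forall fun x => ?_)
  rw [norm_smul]
  exact mul_le_mul_of_nonneg_left (hM x) (norm_nonneg _)

/-! ### Inverse branches and the transfer of Cauchy kernels. -/

/-- The inverse branch of the Boole map with values in `(0, ∞)`. -/
noncomputable def posBranch (y : ℝ) : ℝ := (y + √(y ^ 2 + 4)) / 2

lemma posBranch_pos (y : ℝ) : 0 < posBranch y := by
  have h : |y| < √(y ^ 2 + 4) := by
    rw [← Real.sqrt_sq_eq_abs]; exact Real.sqrt_lt_sqrt (sq_nonneg y) (by linarith)
  have := neg_abs_le y
  unfold posBranch; linarith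

lemma boole_posBranch (y : ℝ) : boole (posBranch y) = y := by
  have h := posBranch_pos y
  have hs : √(y ^ 2 + 4) ^ 2 = y ^ 2 + 4 := Real.sq_sqrt (by positivity)
  unfold boole
  rw [sub_eq_iff_eq_add, ← sub_eq_iff_eq_add', eq_div_iff h.ne']
  unfold posBranch
  nlinarith

lemma boole_injOn_pos : Set.InjOn boole (Set.Ioi 0) := by
  intro x hx y hy h
  simp only [Set.mem_Ioi] at hx hy
  unfold boole at h
  have h1 : (x - y) * (1 + 1 / (x * y)) = 0 := by
    have : (x - y) * (1 + 1 / (x * y)) = (x - 1 / x) - (y - 1 / y) := by field_simp; ring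
    rw [this, h, sub_self]
  rcases mul_eq_zero.1 h1 with h2 | h2
  · linarith
  · have : 0 < 1 / (x * y) := by positivity
    linarith

lemma posBranch_boole {x : ℝ} (hx : 0 < x) : posBranch (boole x) = x :=
  boole_injOn_pos (posBranch_pos _) hx (boole_posBranch _)

/-- The two preimages of a point are `u` and `-1/u`, so the negative inverse branch is `-(posBranch
y)⁻¹`. -/
lemma boole_neg_inv (x : ℝ) : boole (-x⁻¹) = boole x := by
  unfold boole
  rcases eq_or_ne x 0 with rfl | hx
  · simp
  · field_simp; ring

lemma hasDerivAt_posBranch (y : ℝ) :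
    HasDerivAt posBranch (posBranch y ^ 2 / (1 + posBranch y ^ 2)) y := by
  have hpos : 0 < y ^ 2 + 4 := by positivity
  have h1 : HasDerivAt (fun y : ℝ => y ^ 2 + 4) (2 * y) y := by
    simpa using (hasDerivAt_pow 2 y).add_const 4
  have h2 := ((hasDerivAt_id y).add (h1.sqrt hpos.ne')).div_const 2
  convert! h2 using 1
  have hu := posBranch_pos y
  have hs : √(y ^ 2 + 4) = posBranch y + (posBranch y)⁻¹ := by
    have h3 := boole_posBranch y
    unfold boole at h3
    have : posBranch y * 2 = y + √(y ^ 2 + 4) := by unfold posBranch; ring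
    rw [one_div] at h3
    linarith
  have hy : y = posBranch y - (posBranch y)⁻¹ := by
    have h3 := boole_posBranch y
    unfold boole at h3
    rw [one_div] at h3
    exact h3.symm
  rw [hs]
  generalize posBranch y = u at *
  subst hy
  field_simp
  ring

lemma hasDerivAt_neg_inv_posBranch (y : ℝ) :
    HasDerivAt (fun y => -(posBranch y)⁻¹) (1 / (1 + posBranch y ^ 2)) y := by
  have hu := posBranch_pos y
  convert! ((hasDerivAt_posBranch y).inv hu.ne').neg using 1
  field_simp

/-- The left side is the transfer operator at `u - 1/u`, summed over the preimages `u` and `-1/u`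
with the branch derivatives as weights. With `z = a + bi`, the factorization `T u - T z = (u - z)(1
+ 1/(uz))` splits the denominator on the right into those of the two terms, as `e3` records. -/
lemma cauchyKernel_transfer (a u : ℝ) {b : ℝ} (hb : 0 < b) (hu : 0 < u) :
    u ^ 2 / (1 + u ^ 2) * cauchyKernel a b u + 1 / (1 + u ^ 2) * cauchyKernel a b (-u⁻¹) =
      cauchyKernel (halfPlaneMap (a, b)).1 (halfPlaneMap (a, b)).2 (u - u⁻¹) := by
  have hab : 0 < a ^ 2 + b ^ 2 := by positivity
  have h1 : 0 < (u - a) ^ 2 + b ^ 2 := by positivity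
  have h2 : 0 < (1 + u * a) ^ 2 + (u * b) ^ 2 := by positivity
  have e2 : cauchyKernel a b (-u⁻¹) = b * u ^ 2 / ((1 + u * a) ^ 2 + (u * b) ^ 2) := by
    unfold cauchyKernel
    rw [div_eq_div_iff (by positivity) h2.ne']
    field_simp
    ring
  have e3 : cauchyKernel (halfPlaneMap (a, b)).1 (halfPlaneMap (a, b)).2 (u - u⁻¹) =
      b * (a ^ 2 + b ^ 2 + 1) * u ^ 2 /
        (((u - a) ^ 2 + b ^ 2) * ((1 + u * a) ^ 2 + (u * b) ^ 2)) := by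
    have hb' : 0 < b * (1 + 1 / (a ^ 2 + b ^ 2)) := by positivity
    unfold cauchyKernel halfPlaneMap
    simp only
    rw [div_eq_div_iff (by positivity) (by positivity)]
    field_simp
    ring
  rw [e2, e3]
  unfold cauchyKernel
  field_simp
  ring

lemma range_posBranch : Set.range posBranch = Set.Ioi 0 := by
  ext x
  exact ⟨by rintro ⟨y, rfl⟩; exact posBranch_pos y, fun hx => ⟨boole x, posBranch_boole hx⟩⟩

lemma range_neg_inv_posBranch : Set.range (fun y => -(posBranch y)⁻¹) = Set.Iio 0 := by
  ext x
  constructor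
  · rintro ⟨y, rfl⟩
    have := posBranch_pos y
    simpa using this
  · intro hx
    have hx' : 0 < -x⁻¹ := by simpa using hx
    refine ⟨boole (-x⁻¹), ?_⟩
    simp only
    rw [posBranch_boole hx']
    simp

lemma posBranch_injective : Function.Injective posBranch :=
  Function.LeftInverse.injective (g := boole) boole_posBranch

/-- The Boole map sends the Cauchy distribution at a point of the upper half-plane to the Cauchy
distribution at the image of that point. -/
lemma integral_cauchyKernel_comp_boole {G : ℝ → ℂ} (hG : Measurable G) {M : ℝ}
    (hM : ∀ x, ‖G x‖ ≤ M) (a : ℝ) {b : ℝ} (hb : 0 < b) :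
    ∫ x, cauchyKernel a b x • G (boole x) =
      ∫ y, cauchyKernel (halfPlaneMap (a, b)).1 (halfPlaneMap (a, b)).2 y • G y := by
  have hint : Integrable fun x => cauchyKernel a b x • G (boole x) :=
    integrable_smul_of_bounded (integrable_cauchyKernel a hb) (hG.comp measurable_boole)
      fun x => hM _
  have hd1 : ∀ y ∈ Set.univ, HasDerivWithinAt posBranch
      (posBranch y ^ 2 / (1 + posBranch y ^ 2)) Set.univ y :=
    fun y _ => (hasDerivAt_posBranch y).hasDerivWithinAt
  have hd2 : ∀ y ∈ Set.univ, HasDerivWithinAt (fun y => -(posBranch y)⁻¹)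
      (1 / (1 + posBranch y ^ 2)) Set.univ y :=
    fun y _ => (hasDerivAt_neg_inv_posBranch y).hasDerivWithinAt
  have hi1 : Set.InjOn posBranch Set.univ := posBranch_injective.injOn
  have hi2 : Set.InjOn (fun y => -(posBranch y)⁻¹) Set.univ :=
    (neg_injective.comp (inv_injective.comp posBranch_injective)).injOn
  have c1 := integral_image_eq_integral_abs_deriv_smul MeasurableSet.univ hd1 hi1
    (fun x => cauchyKernel a b x • G (boole x))
  have c2 := integral_image_eq_integral_abs_deriv_smul MeasurableSet.univ hd2 hi2
    (fun x => cauchyKernel a b x • G (boole x))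
  have j1 := (integrableOn_image_iff_integrableOn_abs_deriv_smul MeasurableSet.univ hd1 hi1
    (fun x => cauchyKernel a b x • G (boole x))).1 hint.integrableOn
  have j2 := (integrableOn_image_iff_integrableOn_abs_deriv_smul MeasurableSet.univ hd2 hi2
    (fun x => cauchyKernel a b x • G (boole x))).1 hint.integrableOn
  rw [Set.image_univ, range_posBranch] at c1
  rw [Set.image_univ, range_neg_inv_posBranch] at c2
  simp only [setIntegral_univ, integrableOn_univ] at c1 c2 j1 j2
  -- The branches have ranges `(0, ∞)` and `(-∞, 0)`; the missing point `0` is null.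
  rw [← integral_add_compl measurableSet_Ioi (s := Set.Ioi (0 : ℝ)) hint, Set.compl_Ioi,
    integral_Iic_eq_integral_Iio, c1, c2, ← integral_add j1 j2]
  refine integral_congr_ae (.of_forall fun y => ?_)
  have hu := posBranch_pos y
  have hy : posBranch y - (posBranch y)⁻¹ = y := by
    simpa [boole] using boole_posBranch y
  have ht := cauchyKernel_transfer a (posBranch y) hb hu
  simp only [boole_neg_inv, boole_posBranch]
  rw [hy] at ht
  rw [abs_of_nonneg (by positivity), abs_of_nonneg (by positivity), smul_smul, smul_smul,
    ← add_smul, ht]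

/-! ### Orbits in the upper half-plane. -/

lemma halfPlaneMap_snd_pos {z : ℝ × ℝ} (hz : 0 < z.2) : 0 < (halfPlaneMap z).2 := by
  unfold halfPlaneMap; simp only; positivity

lemma halfPlaneMap_iterate_snd_pos {z : ℝ × ℝ} (hz : 0 < z.2) (n : ℕ) :
    0 < (halfPlaneMap^[n] z).2 := by
  induction n with
  | zero => exact hz
  | succ n ih => rw [Function.iterate_succ_apply']; exact halfPlaneMap_snd_pos ih

lemma integral_cauchyKernel_comp_boole_iterate {G : ℝ → ℂ} (hG : Measurable G) {M : ℝ}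
    (hM : ∀ x, ‖G x‖ ≤ M) {z : ℝ × ℝ} (hz : 0 < z.2) (n : ℕ) :
    ∫ x, cauchyKernel z.1 z.2 x • G (boole^[n] x) =
      ∫ y, cauchyKernel (halfPlaneMap^[n] z).1 (halfPlaneMap^[n] z).2 y • G y := by
  induction n generalizing z with
  | zero => rfl
  | succ n ih =>
    simp only [Function.iterate_succ_apply]
    rw [← ih (halfPlaneMap_snd_pos hz)]
    exact integral_cauchyKernel_comp_boole (G := fun x => G (boole^[n] x))
      (hG.comp (measurable_boole_iterate n)) (fun x => hM _) z.1 hz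

lemma le_halfPlaneMap_snd {z : ℝ × ℝ} (hz : 0 < z.2) : z.2 ≤ (halfPlaneMap z).2 := by
  unfold halfPlaneMap
  simp only
  have : 0 < 1 / (z.1 ^ 2 + z.2 ^ 2) := by positivity
  nlinarith

/-- For `|z| ≥ 1` the real part is multiplied by a factor in `[0, 1]`. For `|z| ≤ 1` its new size is
at most `|x| / |z|²`, and `|x| y ≤ |z|²`. -/
lemma abs_halfPlaneMap_fst_le {z : ℝ × ℝ} (hz : 0 < z.2) :
    |(halfPlaneMap z).1| ≤ max |z.1| (1 / z.2) := by
  obtain ⟨x, y⟩ := z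
  simp only at hz
  unfold halfPlaneMap
  simp only
  have hr : 0 < x ^ 2 + y ^ 2 := by positivity
  rw [abs_mul]
  rcases le_total 1 (x ^ 2 + y ^ 2) with h | h
  · refine le_max_of_le_left (mul_le_of_le_one_right (abs_nonneg _) ?_)
    have h1 : 1 / (x ^ 2 + y ^ 2) ≤ 1 := (div_le_one hr).2 h
    have h2 : 0 < 1 / (x ^ 2 + y ^ 2) := by positivity
    rw [abs_le]; constructor <;> linarith
  · refine le_max_of_le_right ?_
    have h1 : 1 ≤ 1 / (x ^ 2 + y ^ 2) := (one_le_div hr).2 h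
    have h2 : |1 - 1 / (x ^ 2 + y ^ 2)| ≤ 1 / (x ^ 2 + y ^ 2) := by
      rw [abs_le]; constructor <;> linarith
    refine (mul_le_mul_of_nonneg_left h2 (abs_nonneg _)).trans ?_
    rw [mul_one_div, div_le_div_iff₀ hr hz, one_mul]
    nlinarith [sq_nonneg (|x| - y), sq_abs x, abs_nonneg x]

lemma halfPlaneMap_iterate_bounds {z : ℝ × ℝ} (hz : 0 < z.2) (n : ℕ) :
    z.2 ≤ (halfPlaneMap^[n] z).2 ∧ |(halfPlaneMap^[n] z).1| ≤ max |z.1| (1 / z.2) := by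
  induction n with
  | zero => exact ⟨le_rfl, le_max_left _ _⟩
  | succ n ih =>
    have hp := halfPlaneMap_iterate_snd_pos hz n
    rw [Function.iterate_succ_apply']
    refine ⟨ih.1.trans (le_halfPlaneMap_snd hp), (abs_halfPlaneMap_fst_le hp).trans ?_⟩
    exact max_le ih.2 (le_max_of_le_right (one_div_le_one_div_of_le hz ih.1))

lemma tendsto_halfPlaneMap_iterate_snd {z : ℝ × ℝ} (hz : 0 < z.2) :
    Tendsto (fun n => (halfPlaneMap^[n] z).2) atTop atTop := by
  set B := max |z.1| (1 / z.2) with hB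
  have hB0 : 0 ≤ B := (abs_nonneg _).trans (le_max_left _ _)
  -- Each step adds at least `2y²/(x² + y²)` to `y²`. This is at least `c`, since `|x| ≤ B` and `y`
  -- never drops below its initial value.
  set c := 2 * z.2 ^ 2 / (B ^ 2 + z.2 ^ 2) with hc
  have hc0 : 0 < c := by positivity
  have key : ∀ n : ℕ, n * c ≤ (halfPlaneMap^[n] z).2 ^ 2 := by
    intro n
    induction n with
    | zero => simp; positivity
    | succ n ih =>
      have hp := halfPlaneMap_iterate_snd_pos hz n
      obtain ⟨h1, h2⟩ := halfPlaneMap_iterate_bounds hz n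
      rw [Function.iterate_succ_apply']
      generalize halfPlaneMap^[n] z = w at *
      have hx : w.1 ^ 2 ≤ B ^ 2 := sq_le_sq.2 (by rwa [abs_of_nonneg hB0])
      have hy : z.2 ^ 2 ≤ w.2 ^ 2 := by gcongr
      have hr : 0 < w.1 ^ 2 + w.2 ^ 2 := by positivity
      have h3 : c ≤ 2 * w.2 ^ 2 * (1 / (w.1 ^ 2 + w.2 ^ 2)) := by
        rw [hc, mul_one_div, div_le_div_iff₀ (by positivity) hr]
        nlinarith [mul_le_mul hx hy (by positivity) (by positivity)]
      have h4 : (halfPlaneMap w).2 ^ 2 = w.2 ^ 2 + 2 * w.2 ^ 2 * (1 / (w.1 ^ 2 + w.2 ^ 2)) +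
          w.2 ^ 2 * (1 / (w.1 ^ 2 + w.2 ^ 2)) ^ 2 := by
        unfold halfPlaneMap; ring
      have h5 : 0 ≤ w.2 ^ 2 * (1 / (w.1 ^ 2 + w.2 ^ 2)) ^ 2 := by positivity
      push_cast
      linarith
  have h1 : Tendsto (fun n : ℕ => (n : ℝ) * c) atTop atTop :=
    tendsto_natCast_atTop_atTop.atTop_mul_const hc0
  have h2 := tendsto_atTop_mono key h1
  rw [tendsto_atTop] at h2 ⊢
  intro R
  filter_upwards [h2 (R ^ 2)] with n hn
  exact (le_abs_self R).trans (abs_le_of_sq_le_sq hn (halfPlaneMap_iterate_snd_pos hz n).le)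

lemma tendsto_halfPlaneMap_iterate_ratio {z : ℝ × ℝ} (hz : 0 < z.2) :
    Tendsto (fun n => (halfPlaneMap^[n] z).1 / (halfPlaneMap^[n] z).2) atTop (𝓝 0) := by
  have h := (tendsto_halfPlaneMap_iterate_snd hz).const_div_atTop (max |z.1| (1 / z.2))
  refine squeeze_zero_norm (fun n => ?_) h
  rw [norm_div, Real.norm_eq_abs, Real.norm_of_nonneg (halfPlaneMap_iterate_snd_pos hz n).le]
  exact div_le_div_of_nonneg_right (halfPlaneMap_iterate_bounds hz n).2
    (halfPlaneMap_iterate_snd_pos hz n).le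

/-! ### Wide Cauchy averages compute the infinite-volume average. -/

/-- The layers of the kernel `1 / (1 + u²)`: integrating in `s` gives the kernel back. -/
noncomputable def layer (p : ℝ × ℝ) : ℝ :=
  if |p.1| < p.2 then 2 * p.2 / (1 + p.2 ^ 2) ^ 2 else 0

lemma measurable_layer : Measurable layer := by
  unfold layer
  refine Measurable.ite (measurableSet_lt (by fun_prop) (by fun_prop)) ?_ measurable_const
  exact Measurable.div (by fun_prop) (by fun_prop)

lemma layer_nonneg (p : ℝ × ℝ) : 0 ≤ layer p := by
  unfold layer
  split_ifs with h
  · have : 0 < p.2 := (abs_nonneg _).trans_lt h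
    positivity
  · exact le_rfl

lemma layer_fst (u : ℝ) :
    (fun s => layer (u, s)) = (Set.Ioi |u|).indicator fun s => 2 * s / (1 + s ^ 2) ^ 2 := by
  funext s
  simp [layer, Set.indicator_apply]

lemma hasDerivAt_neg_inv_one_add_sq (s : ℝ) :
    HasDerivAt (fun s : ℝ => -(1 + s ^ 2)⁻¹) (2 * s / (1 + s ^ 2) ^ 2) s := by
  have h1 : HasDerivAt (fun s : ℝ => 1 + s ^ 2) (2 * s) s := by
    simpa using (hasDerivAt_pow 2 s).const_add 1
  convert! (h1.inv (by positivity)).neg using 1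
  ring

lemma tendsto_neg_inv_one_add_sq : Tendsto (fun s : ℝ => -(1 + s ^ 2)⁻¹) atTop (𝓝 0) := by
  have : Tendsto (fun s : ℝ => 1 + s ^ 2) atTop atTop :=
    tendsto_atTop_add_const_left _ _ (tendsto_pow_atTop two_ne_zero)
  simpa using this.inv_tendsto_atTop.neg

lemma integrable_layer_fst (u : ℝ) : Integrable fun s => layer (u, s) := by
  rw [layer_fst, integrable_indicator_iff measurableSet_Ioi]
  refine integrableOn_Ioi_deriv_of_nonneg' (fun s _ => hasDerivAt_neg_inv_one_add_sq s) ?_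
    tendsto_neg_inv_one_add_sq
  intro s hs
  have : 0 < s := (abs_nonneg _).trans_lt hs
  positivity

lemma integral_layer_fst (u : ℝ) : ∫ s, layer (u, s) = cauchyKernel 0 1 u := by
  rw [layer_fst, integral_indicator measurableSet_Ioi,
    integral_Ioi_of_hasDerivAt_of_nonneg' (fun s _ => hasDerivAt_neg_inv_one_add_sq s) ?_
    tendsto_neg_inv_one_add_sq, cauchyKernel_zero_one]
  · simp
  · intro s hs
    have : 0 < s := (abs_nonneg _).trans_lt hs
    positivity

lemma integrable_layer : Integrable layer (volume.prod volume) := by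
  refine (integrable_prod_iff measurable_layer.aestronglyMeasurable).2
    ⟨.of_forall integrable_layer_fst, ?_⟩
  simp only [Real.norm_of_nonneg (layer_nonneg _), integral_layer_fst]
  exact integrable_cauchyKernel_zero_one

/-- At fixed height `s` the layer is a multiple of the indicator of `(-s, s)`, which turns Cauchy
averages into the symmetric averages of `HasAvg`. -/
lemma integral_layer_snd_smul (H : ℝ → ℂ) {s : ℝ} (hs : 0 < s) :
    ∫ u, layer (u, s) • H u = (2 * s / (1 + s ^ 2) ^ 2) • ∫ u in (-s)..s, H u := by
  have : (fun u => layer (u, s) • H u) =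
      (Set.Ioo (-s) s).indicator fun u => (2 * s / (1 + s ^ 2) ^ 2) • H u := by
    funext u
    simp only [layer, Set.indicator_apply, Set.mem_Ioo, abs_lt]
    split_ifs <;> simp
  rw [this, integral_indicator measurableSet_Ioo, integral_smul,
    intervalIntegral.integral_of_le (by linarith), integral_Ioc_eq_integral_Ioo]

lemma layer_eq_zero (u : ℝ) {s : ℝ} (hs : s ≤ 0) : layer (u, s) = 0 := by
  simp only [layer, ite_eq_right_iff]
  intro h
  exact absurd h (not_lt.2 (hs.trans (abs_nonneg u)))

/-- The averages of `G` against dilated centred Cauchy distributions converge to its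
infinite-volume average. -/
lemma tendsto_integral_cauchyKernel_comp_mul {G : ℝ → ℂ} (hG : Measurable G) {M : ℝ}
    (hM : ∀ x, ‖G x‖ ≤ M) {L : ℂ} (hL : HasAvg G L) :
    Tendsto (fun b : ℝ => ∫ u, cauchyKernel 0 1 u • G (b * u)) atTop
      (𝓝 ((Real.pi : ℝ) • L)) := by
  have hGb : ∀ b : ℝ, Measurable fun u => G (b * u) := fun b => hG.comp (by fun_prop)
  have hlay : ∀ b : ℝ, Integrable (fun p : ℝ × ℝ => layer p • G (b * p.1))
      (volume.prod volume) := fun b =>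
    integrable_smul_of_bounded integrable_layer ((hGb b).comp measurable_fst) fun p => hM _
  have hswap : ∀ b : ℝ, ∫ u, cauchyKernel 0 1 u • G (b * u) =
      ∫ s, ∫ u, layer (u, s) • G (b * u) := by
    intro b
    rw [← integral_integral_swap (f := fun u s => layer (u, s) • G (b * u)) (hlay b)]
    refine integral_congr_ae (.of_forall fun u => ?_)
    simp only
    rw [integral_smul_const, integral_layer_fst]
  have hlim : (Real.pi : ℝ) • L = ∫ s, (∫ u, layer (u, s)) • L := by
    rw [integral_smul_const, ← integral_integral_swap (f := fun u s => layer (u, s))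
      integrable_layer]
    simp only [integral_layer_fst, integral_cauchyKernel_zero_one]
  simp_rw [hswap]
  rw [hlim]
  -- For fixed `s > 0` the inner integral is the mass of the layer times the average of `G` over
  -- `[-bs, bs]`, which tends to `L`; the mass times `M` dominates.
  refine tendsto_integral_filter_of_dominated_convergence (fun s => (∫ u, layer (u, s)) * M)
    (.of_forall fun b => (hlay b).integral_prod_right.aestronglyMeasurable)
    (.of_forall fun b => .of_forall fun s => ?_)
    (integrable_layer.integral_prod_right.mul_const M) (.of_forall fun s => ?_)
  · rcases le_or_gt s 0 with hs | hs
    · simp [layer_eq_zero _ hs]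
    have hi : Integrable fun u => layer (u, s) := by
      have : (fun u => layer (u, s)) =
          (Set.Ioo (-s) s).indicator fun u => 2 * s / (1 + s ^ 2) ^ 2 := by
        funext u
        simp [layer, Set.indicator_apply, abs_lt]
      rw [this, integrable_indicator_iff measurableSet_Ioo]
      exact integrableOn_const (by simp)
    rw [← integral_mul_const]
    refine norm_integral_le_of_norm_le (hi.mul_const M) (.of_forall fun u => ?_)
    rw [norm_smul, Real.norm_of_nonneg (layer_nonneg _)]
    exact mul_le_mul_of_nonneg_left (hM _) (layer_nonneg _)
  · rcases le_or_gt s 0 with hs | hs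
    · simp [layer_eq_zero _ hs]
    have h1 : ∫ u, layer (u, s) = 2 * s / (1 + s ^ 2) ^ 2 * (2 * s) := by
      have := integral_layer_snd_smul (fun _ => 1) hs
      simp only [intervalIntegral.integral_const, Complex.real_smul, mul_one] at this
      rw [integral_complex_ofReal] at this
      have h2 := Complex.ofReal_injective (this.trans (Complex.ofReal_mul _ _).symm)
      rw [h2]; ring
    have h2 : Tendsto (fun b : ℝ => ((1 / (2 * (b * s)) : ℝ) : ℂ) * ∫ x in (-(b * s))..(b * s), G x)
        atTop (𝓝 L) := hL.comp (tendsto_id.atTop_mul_const hs)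
    rw [h1]
    refine (h2.const_smul (2 * s / (1 + s ^ 2) ^ 2 * (2 * s))).congr' ?_
    filter_upwards [eventually_gt_atTop 0] with b hb
    rw [integral_layer_snd_smul _ hs, intervalIntegral.integral_comp_mul_left G hb.ne', mul_neg]
    simp only [Complex.real_smul, ← mul_assoc, ← Complex.ofReal_mul]
    congr 2
    field_simp

lemma cauchyKernel_one_le {t : ℝ} (ht : |t| ≤ 1) (u : ℝ) :
    cauchyKernel t 1 u ≤ 3 * cauchyKernel 0 1 u := by
  have h2 : t ^ 2 ≤ 1 := by
    rw [← sq_abs]; exact pow_le_one₀ (abs_nonneg t) ht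
  unfold cauchyKernel
  rw [← mul_div_assoc, div_le_div_iff₀ (by positivity) (by positivity)]
  nlinarith [sq_nonneg (u - 2 * t)]

lemma tendsto_integral_abs_cauchyKernel_sub :
    Tendsto (fun t : ℝ => ∫ u, |cauchyKernel t 1 u - cauchyKernel 0 1 u|) (𝓝 0) (𝓝 0) := by
  suffices h : Tendsto (fun t : ℝ => ∫ u, |cauchyKernel t 1 u - cauchyKernel 0 1 u|) (𝓝 0)
      (𝓝 (∫ _ : ℝ, 0)) by simpa using h
  -- The constant is `3 + 1`, from `cauchyKernel_one_le` for `|t| ≤ 1` and the centred kernel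
  -- itself.
  refine tendsto_integral_filter_of_dominated_convergence (fun u => 4 * cauchyKernel 0 1 u)
    (.of_forall fun t => ?_) ?_ (integrable_cauchyKernel_zero_one.const_mul 4)
    (.of_forall fun u => ?_)
  · exact (((continuous_cauchyKernel t one_pos).sub
      (continuous_cauchyKernel 0 one_pos)).abs).aestronglyMeasurable
  · have : ∀ᶠ t : ℝ in 𝓝 0, |t| ≤ 1 := by
      filter_upwards [Metric.closedBall_mem_nhds (0 : ℝ) one_pos] with t ht
      simpa using ht
    filter_upwards [this] with t ht
    refine .of_forall fun u => ?_
    have h1 := cauchyKernel_one_le ht u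
    have h2 := cauchyKernel_nonneg t one_pos u
    have h3 := cauchyKernel_nonneg 0 one_pos u
    rw [Real.norm_eq_abs, abs_abs, abs_le]
    constructor <;> linarith
  · have hc : Continuous fun t : ℝ => |cauchyKernel t 1 u - cauchyKernel 0 1 u| := by
      unfold cauchyKernel
      refine ((continuous_const.div (by fun_prop) fun t => ?_).sub continuous_const).abs
      exact (cauchyKernel_denom_pos one_pos u).ne'
    simpa using hc.tendsto 0

/-- Rescaling by `b n` leaves a unit-scale kernel at `a n / b n → 0`, which is `L¹`-close to the
centred one; boundedness of `G` absorbs the difference. -/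
lemma HasAvg.tendsto_integral_cauchyKernel {G : ℝ → ℂ} (hG : Measurable G) {M : ℝ}
    (hM : ∀ x, ‖G x‖ ≤ M) {L : ℂ} (hL : HasAvg G L) {a b : ℕ → ℝ} (hb : ∀ n, 0 < b n)
    (hb' : Tendsto b atTop atTop) (hab : Tendsto (fun n => a n / b n) atTop (𝓝 0)) :
    Tendsto (fun n => ∫ x, cauchyKernel (a n) (b n) x • G x) atTop (𝓝 ((Real.pi : ℝ) • L)) := by
  have h1 := (tendsto_integral_cauchyKernel_comp_mul hG hM hL).comp hb'
  have h2 : Tendsto (fun n => ∫ u, (cauchyKernel (a n / b n) 1 u - cauchyKernel 0 1 u) •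
      G (b n * u)) atTop (𝓝 0) := by
    have h3 := ((tendsto_integral_abs_cauchyKernel_sub.comp hab).mul_const M)
    rw [zero_mul] at h3
    refine squeeze_zero_norm (fun n => ?_) h3
    simp only [Function.comp_apply]
    rw [← integral_mul_const]
    refine norm_integral_le_of_norm_le ?_ (.of_forall fun u => ?_)
    · exact (((integrable_cauchyKernel _ one_pos).sub
        (integrable_cauchyKernel _ one_pos)).abs).mul_const M
    · rw [norm_smul, Real.norm_eq_abs]
      exact mul_le_mul_of_nonneg_left (hM _) (abs_nonneg _)
  have h4 := h1.add h2
  rw [add_zero] at h4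
  refine h4.congr fun n => ?_
  have hm : Measurable fun u => G (b n * u) := hG.comp (by fun_prop)
  have h5 := integral_smul_cauchyKernel G (a n) 0 (hb n)
  simp only [sub_zero, zero_add] at h5
  simp only [Function.comp_apply]
  have i1 := integrable_smul_of_bounded (integrable_cauchyKernel 0 one_pos) hm fun x => hM _
  have i2 : Integrable fun u => (cauchyKernel (a n / b n) 1 u - cauchyKernel 0 1 u) •
      G (b n * u) :=
    integrable_smul_of_bounded ((integrable_cauchyKernel _ one_pos).sub
      (integrable_cauchyKernel _ one_pos)) hm fun x => hM _
  rw [h5, ← integral_add i1 i2]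
  refine integral_congr_ae (.of_forall fun u => ?_)
  simp only
  rw [← add_smul, add_sub_cancel]

/-- Global-local mixing tested against Cauchy distributions. -/
lemma HasAvg.tendsto_integral_cauchyKernel_comp_boole_iterate {G : ℝ → ℂ} (hG : Measurable G)
    {M : ℝ} (hM : ∀ x, ‖G x‖ ≤ M) {L : ℂ} (hL : HasAvg G L) (a : ℝ) {b : ℝ} (hb : 0 < b) :
    Tendsto (fun n => ∫ x, cauchyKernel a b x • G (boole^[n] x)) atTop
      (𝓝 ((Real.pi : ℝ) • L)) := by
  have hz : 0 < ((a, b) : ℝ × ℝ).2 := hb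
  refine (hL.tendsto_integral_cauchyKernel hG hM (halfPlaneMap_iterate_snd_pos hz)
    (tendsto_halfPlaneMap_iterate_snd hz) (tendsto_halfPlaneMap_iterate_ratio hz)).congr
    fun n => ?_
  exact (integral_cauchyKernel_comp_boole_iterate hG hM hz n).symm

/-! ### From Cauchy laws to all integrable densities. -/

/-- The `L¹` modulus of continuity of translations of `g`. -/
noncomputable def translationModulus (g : ℝ → ℝ) (s : ℝ) : ℝ := ∫ t, ‖g (s + t) - g t‖

/-- This is the continuity of the translation action on `L¹`, with the action expressed through
`DomAddAct`. -/
lemma continuous_translationModulus {g : ℝ → ℝ} (hg : Integrable g) :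
    Continuous (translationModulus g) := by
  have hm : MemLp g 1 volume := memLp_one_iff_integrable.2 hg
  have : Fact ((1 : ENNReal) ≠ ⊤) := ⟨ENNReal.one_ne_top⟩
  have hs : ∀ s : ℝ, MemLp (fun t => g (s + t)) 1 volume := fun s =>
    memLp_one_iff_integrable.2 (hg.comp_add_left s)
  have hv : ∀ s : ℝ, (hs s).toLp = DomAddAct.mk s +ᵥ hm.toLp g := fun s => rfl
  have h : translationModulus g = fun s : ℝ => ‖(hs s).toLp - hm.toLp g‖ := by
    funext s
    rw [← MemLp.toLp_sub, L1.norm_eq_integral_norm]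
    refine integral_congr_ae ?_
    filter_upwards [MemLp.coeFn_toLp ((hs s).sub hm)] with t ht
    rw [ht]
    rfl
  rw [h]
  simp only [hv]
  have hc : Continuous fun s : ℝ => DomAddAct.mk s +ᵥ hm.toLp g :=
    DomAddAct.mkHomeomorph.continuous.vadd continuous_const
  exact (hc.sub continuous_const).norm

lemma translationModulus_zero (g : ℝ → ℝ) : translationModulus g 0 = 0 := by
  simp [translationModulus]

lemma translationModulus_nonneg (g : ℝ → ℝ) (s : ℝ) : 0 ≤ translationModulus g s :=
  integral_nonneg fun _ => norm_nonneg _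

lemma translationModulus_le {g : ℝ → ℝ} (hg : Integrable g) (s : ℝ) :
    translationModulus g s ≤ 2 * ∫ t, ‖g t‖ := by
  have h1 : ∫ t, ‖g (s + t)‖ = ∫ t, ‖g t‖ :=
    integral_add_left_eq_self (μ := volume) (fun t => ‖g t‖) s
  calc translationModulus g s ≤ ∫ t, (‖g (s + t)‖ + ‖g t‖) :=
        integral_mono ((hg.comp_add_left s).sub hg).norm
          ((hg.comp_add_left s).norm.add hg.norm) fun t => norm_sub_le _ _
    _ = 2 * ∫ t, ‖g t‖ := by
        rw [integral_add (hg.comp_add_left s).norm hg.norm, h1]; ring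

lemma tendsto_integral_translationModulus {g : ℝ → ℝ} (hg : Integrable g) :
    Tendsto (fun r : ℝ => ∫ u, cauchyKernel 0 1 u * translationModulus g (r * u)) (𝓝 0)
      (𝓝 0) := by
  suffices h : Tendsto (fun r : ℝ => ∫ u, cauchyKernel 0 1 u * translationModulus g (r * u))
      (𝓝 0) (𝓝 (∫ _ : ℝ, 0)) by simpa using h
  have hc := continuous_translationModulus hg
  refine tendsto_integral_filter_of_dominated_convergence
    (fun u => cauchyKernel 0 1 u * (2 * ∫ t, ‖g t‖)) (.of_forall fun r => ?_)
    (.of_forall fun r => .of_forall fun u => ?_)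
    (integrable_cauchyKernel_zero_one.mul_const _) (.of_forall fun u => ?_)
  · exact ((continuous_cauchyKernel 0 one_pos).mul
      (hc.comp (by fun_prop))).aestronglyMeasurable
  · rw [Real.norm_of_nonneg (mul_nonneg (cauchyKernel_nonneg 0 one_pos u)
      (translationModulus_nonneg g _))]
    exact mul_le_mul_of_nonneg_left (translationModulus_le hg _)
      (cauchyKernel_nonneg 0 one_pos u)
  · have h : Continuous fun r : ℝ => cauchyKernel 0 1 u * translationModulus g (r * u) :=
      continuous_const.mul (hc.comp (by fun_prop))
    simpa [translationModulus_zero] using h.tendsto 0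

/-- The translation is moved from `H`, which need not be continuous, onto `g`. -/
lemma norm_integral_smul_sub_translate_le {g : ℝ → ℝ} (hg : Integrable g) {H : ℝ → ℂ}
    (hH : Measurable H) {M : ℝ} (hM : ∀ x, ‖H x‖ ≤ M) (s : ℝ) :
    ‖(∫ t, g t • H (t + s)) - ∫ t, g t • H t‖ ≤ translationModulus g (-s) * M := by
  have h1 : ∫ t, g t • H (t + s) = ∫ t, g (-s + t) • H t := by
    rw [← integral_add_left_eq_self (μ := volume) (fun t => g (-s + t) • H t) s]
    simp [add_comm]
  rw [h1, ← integral_sub (integrable_smul_of_bounded (hg.comp_add_left (-s)) hH hM)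
    (integrable_smul_of_bounded hg hH hM)]
  unfold translationModulus
  rw [← integral_mul_const]
  refine norm_integral_le_of_norm_le ((((hg.comp_add_left (-s)).sub hg).norm).mul_const M)
    (.of_forall fun t => ?_)
  rw [← sub_smul, norm_smul]
  exact mul_le_mul_of_nonneg_left (hM _) (norm_nonneg _)

/-- Testing against `g` is close to testing against the convolution of `g` with a Cauchy
distribution of small scale. -/
lemma norm_pi_smul_integral_sub_le {g : ℝ → ℝ} (hg : Integrable g) {H : ℝ → ℂ}
    (hH : Measurable H) {M : ℝ} (hM : ∀ x, ‖H x‖ ≤ M) {r : ℝ} (hr : 0 < r) :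
    ‖(∫ t, g t • ∫ x, cauchyKernel t r x • H x) - (Real.pi : ℝ) • ∫ t, g t • H t‖ ≤
      (∫ u, cauchyKernel 0 1 u * translationModulus g (-r * u)) * M := by
  have hk := integrable_cauchyKernel_zero_one
  have hprod : Integrable (fun p : ℝ × ℝ => (g p.1 * cauchyKernel 0 1 p.2) • H (p.1 + r * p.2))
      (volume.prod volume) :=
    integrable_smul_of_bounded (hg.mul_prod hk) (hH.comp (by fun_prop)) fun p => hM _
  have h1 : ∫ t, g t • ∫ x, cauchyKernel t r x • H x =
      ∫ u, cauchyKernel 0 1 u • ∫ t, g t • H (t + r * u) := by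
    calc ∫ t, g t • ∫ x, cauchyKernel t r x • H x
        = ∫ t, ∫ u, (g t * cauchyKernel 0 1 u) • H (t + r * u) := by
          refine integral_congr_ae (.of_forall fun t => ?_)
          simp only
          rw [integral_smul_cauchyKernel H t t hr, sub_self, zero_div, ← integral_smul]
          simp only [smul_smul]
      _ = ∫ u, ∫ t, (g t * cauchyKernel 0 1 u) • H (t + r * u) :=
          integral_integral_swap hprod
      _ = _ := by
          refine integral_congr_ae (.of_forall fun u => ?_)
          simp only
          rw [← integral_smul]
          simp only [smul_smul, mul_comm]
  have h2 : (Real.pi : ℝ) • ∫ t, g t • H t = ∫ u, cauchyKernel 0 1 u • ∫ t, g t • H t := by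
    rw [integral_smul_const, integral_cauchyKernel_zero_one]
  have hi1 : Integrable fun u => cauchyKernel 0 1 u • ∫ t, g t • H (t + r * u) := by
    refine hprod.integral_prod_right.congr (.of_forall fun u => ?_)
    simp only
    rw [← integral_smul]
    simp only [smul_smul, mul_comm]
  rw [h1, h2, ← integral_sub hi1 (hk.smul_const _), ← integral_mul_const]
  have hc := continuous_translationModulus hg
  refine norm_integral_le_of_norm_le (Integrable.mul_const ?_ M) (.of_forall fun u => ?_)
  · refine (hk.mul_const (2 * ∫ t, ‖g t‖)).mono' ((continuous_cauchyKernel 0 one_pos).mul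
      (hc.comp (by fun_prop))).aestronglyMeasurable (.of_forall fun u => ?_)
    rw [Real.norm_of_nonneg (mul_nonneg (cauchyKernel_nonneg 0 one_pos u)
      (translationModulus_nonneg g _))]
    exact mul_le_mul_of_nonneg_left (translationModulus_le hg _)
      (cauchyKernel_nonneg 0 one_pos u)
  · have h0 := cauchyKernel_nonneg 0 one_pos u
    rw [← smul_sub, norm_smul, Real.norm_of_nonneg h0, mul_assoc, neg_mul]
    exact mul_le_mul_of_nonneg_left (norm_integral_smul_sub_translate_le hg hH hM _) h0

/-- Global-local mixing of the Boole map. -/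
theorem HasAvg.tendsto_integral_smul_comp_boole_iterate {G : ℝ → ℂ} (hG : Measurable G)
    {M : ℝ} (hM : ∀ x, ‖G x‖ ≤ M) {L : ℂ} (hL : HasAvg G L) {g : ℝ → ℝ} (hg : Integrable g) :
    Tendsto (fun n => ∫ x, g x • G (boole^[n] x)) atTop (𝓝 ((∫ x, g x) • L)) := by
  have hM0 : 0 ≤ M := (norm_nonneg _).trans (hM 0)
  have hGn : ∀ n, Measurable fun x => G (boole^[n] x) := fun n =>
    hG.comp (measurable_boole_iterate n)
  have hk : ∀ r : ℝ, 0 < r → Tendsto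
      (fun n => ∫ t, g t • ∫ x, cauchyKernel t r x • G (boole^[n] x)) atTop
      (𝓝 ((Real.pi : ℝ) • (∫ x, g x) • L)) := by
    intro r hr
    have hlim : (Real.pi : ℝ) • (∫ x, g x) • L = ∫ t, g t • ((Real.pi : ℝ) • L) := by
      rw [integral_smul_const, smul_comm]
    rw [hlim]
    have hrep : ∀ n t, ∫ x, cauchyKernel t r x • G (boole^[n] x) =
        ∫ u, cauchyKernel 0 1 u • G (boole^[n] (t + r * u)) := by
      intro n t
      rw [integral_smul_cauchyKernel (fun x => G (boole^[n] x)) t t hr, sub_self, zero_div]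
    refine tendsto_integral_of_dominated_convergence (fun t => ‖g t‖ * (Real.pi * M))
      (fun n => ?_) (hg.norm.mul_const _) (fun n => .of_forall fun t => ?_)
      (.of_forall fun t => ?_)
    · refine hg.aestronglyMeasurable.smul ?_
      simp only [hrep]
      refine StronglyMeasurable.aestronglyMeasurable ?_
      refine StronglyMeasurable.integral_prod_right
        (f := fun t u => cauchyKernel 0 1 u • G (boole^[n] (t + r * u))) ?_
      refine Measurable.stronglyMeasurable ?_
      exact ((continuous_cauchyKernel 0 one_pos).measurable.comp measurable_snd).smul
        ((hGn n).comp (by fun_prop))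
    · rw [norm_smul, hrep, ← integral_cauchyKernel_zero_one, ← integral_mul_const]
      refine mul_le_mul_of_nonneg_left ?_ (norm_nonneg _)
      refine norm_integral_le_of_norm_le (integrable_cauchyKernel_zero_one.mul_const M)
        (.of_forall fun u => ?_)
      rw [norm_smul, Real.norm_of_nonneg (cauchyKernel_nonneg 0 one_pos u)]
      exact mul_le_mul_of_nonneg_left (hM _) (cauchyKernel_nonneg 0 one_pos u)
    · exact (hL.tendsto_integral_cauchyKernel_comp_boole_iterate hG hM t hr).const_smul (g t)
  have hpi : Tendsto (fun n => (Real.pi : ℝ) • ∫ x, g x • G (boole^[n] x)) atTop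
      (𝓝 ((Real.pi : ℝ) • (∫ x, g x) • L)) := by
    rw [Metric.tendsto_atTop]
    intro ε hε
    have h1 : Tendsto (fun r : ℝ =>
        (∫ u, cauchyKernel 0 1 u * translationModulus g (-r * u)) * M) (𝓝[>] 0) (𝓝 0) := by
      have h2 : Tendsto (fun r : ℝ => -r) (𝓝[>] 0) (𝓝 0) := by
        simpa using (continuous_neg.tendsto (0 : ℝ)).mono_left nhdsWithin_le_nhds
      simpa using ((tendsto_integral_translationModulus hg).comp h2).mul_const M
    -- The smoothing error depends on `g`, `M` and `r` but not on `n`, so `r` can be fixed before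
    -- `N`.
    obtain ⟨r, hr1, hr⟩ := ((h1.eventually_lt_const (half_pos hε)).and
      self_mem_nhdsWithin).exists
    obtain ⟨N, hN⟩ := Metric.tendsto_atTop.1 (hk r hr) (ε / 2) (half_pos hε)
    refine ⟨N, fun n hn => ?_⟩
    have h3 := norm_pi_smul_integral_sub_le hg (hGn n) (fun x => hM _) (r := r) hr
    have h4 := hN n hn
    rw [← dist_eq_norm, dist_comm] at h3
    calc _ ≤ _ := dist_triangle _ _ _
      _ < ε / 2 + ε / 2 := add_lt_add (h3.trans_lt hr1) h4
      _ = ε := add_halves ε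
  have h5 := hpi.const_smul (Real.pi)⁻¹
  simpa only [inv_smul_smul₀ Real.pi_ne_zero] using h5

/-- Global-local mixing for initial distributions absolutely continuous with respect to Lebesgue
measure. -/
theorem HasAvg.tendsto_integral_comp_boole_iterate {G : ℝ → ℂ} (hG : Measurable G)
    {M : ℝ} (hM : ∀ x, ‖G x‖ ≤ M) {L : ℂ} (hL : HasAvg G L) (ν : Measure ℝ)
    [IsProbabilityMeasure ν] (hν : ν ≪ volume) :
    Tendsto (fun n => ∫ x, G (boole^[n] x) ∂ν) atTop (𝓝 L) := by
  have h := hL.tendsto_integral_smul_comp_boole_iterate hG hM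
    (g := fun x => (ν.rnDeriv volume x).toReal) Measure.integrable_toReal_rnDeriv
  simp only [integral_rnDeriv_smul hν] at h
  rw [Measure.integral_toReal_rnDeriv hν] at h
  simpa using h

/-! ### Escape of mass to infinity. -/

lemma HasAvg.of_integrable {G : ℝ → ℂ} (hG : Integrable G) : HasAvg G 0 := by
  have h1 : Tendsto (fun a : ℝ => ((1 / (2 * a) : ℝ) : ℂ)) atTop (𝓝 0) := by
    have h : Tendsto (fun a : ℝ => 1 / (2 * a)) atTop (𝓝 0) :=
      (tendsto_id.const_mul_atTop two_pos).const_div_atTop 1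
    rw [← Complex.ofReal_zero]
    exact (Complex.continuous_ofReal.tendsto 0).comp h
  have h2 := h1.mul (intervalIntegral_tendsto_integral hG tendsto_neg_atTop_atBot tendsto_id)
  rwa [zero_mul] at h2

/-- The indicator of a set of finite measure is integrable, hence has infinite-volume average `0`;
mixing does the rest. -/
lemma tendsto_measure_boole_iterate_mem {s : Set ℝ} (hs : MeasurableSet s) (hs' : volume s ≠ ⊤)
    (ν : Measure ℝ) [IsProbabilityMeasure ν] (hν : ν ≪ volume) :
    Tendsto (fun n => ν {x | boole^[n] x ∈ s}) atTop (𝓝 0) := by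
  have hi : Integrable (s.indicator fun _ => (1 : ℂ)) :=
    (integrable_indicator_iff hs).2 (integrableOn_const hs')
  have h := (HasAvg.of_integrable hi).tendsto_integral_comp_boole_iterate
    (measurable_const.indicator hs) (M := 1)
    (fun x => (norm_indicator_le_norm_self _ _).trans (by simp)) ν hν
  have h2 : ∀ n, ‖∫ x, s.indicator (fun _ => (1 : ℂ)) (boole^[n] x) ∂ν‖ =
      ν.real {x | boole^[n] x ∈ s} := by
    intro n
    have : (fun x => s.indicator (fun _ => (1 : ℂ)) (boole^[n] x)) =
        (boole^[n] ⁻¹' s).indicator fun _ => (1 : ℂ) := rfl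
    rw [this, integral_indicator (measurable_boole_iterate n hs)]
    simp [Set.preimage]
  have h3 := h.norm
  simp only [h2, norm_zero] at h3
  exact (ENNReal.tendsto_toReal_zero_iff fun _ => measure_ne_top _ _).1 h3

lemma tendstoInMeasure_comp_boole_iterate {W : ℝ → ℝ} (hW : Tendsto W (cocompact ℝ) (𝓝 0))
    (ν : Measure ℝ) [IsProbabilityMeasure ν] (hν : ν ≪ volume) :
    TendstoInMeasure ν (fun n x => W (boole^[n] x)) atTop 0 := by
  rw [tendstoInMeasure_iff_norm]
  intro ε hε
  have h1 : {x | ‖W x‖ < ε} ∈ cocompact ℝ := by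
    filter_upwards [hW.norm.eventually_lt_const (by simpa using hε)] with x hx using hx
  obtain ⟨K, hK, hKs⟩ := mem_cocompact.1 h1
  refine tendsto_of_tendsto_of_tendsto_of_le_of_le tendsto_const_nhds
    (tendsto_measure_boole_iterate_mem hK.measurableSet hK.measure_lt_top.ne ν hν)
    (fun _ => bot_le) fun n => measure_mono fun x hx => ?_
  by_contra hx'
  have : ‖W (boole^[n] x)‖ < ε := hKs hx'
  simp only [Set.mem_ofPred_eq, Pi.zero_apply, sub_zero] at hx
  linarith

/-! ### Near infinity, Birkhoff averages of `F` differ little from `F`. -/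

lemma tendsto_boole_sub_self : Tendsto (fun x => boole x - x) (cocompact ℝ) (𝓝 0) := by
  have : (fun x : ℝ => boole x - x) = fun x => -x⁻¹ := by
    funext x; simp [boole]
  rw [this]
  simpa using (tendsto_inv₀_cobounded (α := ℝ)).neg

lemma tendsto_cocompact_of_sub {f : ℝ → ℝ}
    (hf : Tendsto (fun x => f x - x) (cocompact ℝ) (𝓝 0)) :
    Tendsto f (cocompact ℝ) (cocompact ℝ) := by
  rw [← Metric.cobounded_eq_cocompact] at hf ⊢
  rw [← tendsto_norm_atTop_iff_cobounded]
  have h2 : ∀ x : ℝ, ‖x‖ + -‖f x - x‖ ≤ ‖f x‖ := fun x => by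
    have := norm_sub_norm_le x (x - f x)
    rw [sub_sub_cancel, norm_sub_rev x] at this
    linarith
  exact tendsto_atTop_mono h2 (tendsto_norm_cobounded_atTop.atTop_add hf.norm.neg)

lemma tendsto_boole_iterate_sub_self (j : ℕ) :
    Tendsto (fun x => boole^[j] x - x) (cocompact ℝ) (𝓝 0) := by
  induction j with
  | zero => simp
  | succ j ih =>
    -- Telescoping: `T^(j+1) x - x = (T (T^j x) - T^j x) + (T^j x - x)`.
    have h := (tendsto_boole_sub_self.comp (tendsto_cocompact_of_sub ih)).add ih
    rw [add_zero] at h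
    refine h.congr fun x => ?_
    simp [Function.iterate_succ_apply']

lemma UniformContinuousAtInfinity.tendsto_comp_sub {F : ℝ → ℝ}
    (hF : UniformContinuousAtInfinity F) {f : ℝ → ℝ}
    (hf : Tendsto (fun x => f x - x) (cocompact ℝ) (𝓝 0)) :
    Tendsto (fun x => F (f x) - F x) (cocompact ℝ) (𝓝 0) := by
  rw [Metric.tendsto_nhds]
  intro ε hε
  obtain ⟨δ, Q, hδ, hQ, h⟩ := hF (ε / 2) (half_pos hε)
  have hout : ∀ᶠ x in cocompact ℝ, x ∉ Set.Ioo (-Q) Q := by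
    filter_upwards [(isCompact_Icc (a := -Q) (b := Q)).compl_mem_cocompact] with x hx h'
    exact hx (Set.Ioo_subset_Icc_self h')
  filter_upwards [hout, (tendsto_cocompact_of_sub hf).eventually hout,
    Metric.tendsto_nhds.1 hf δ hδ] with x h1 h2 h3
  rw [dist_zero_right, Real.norm_eq_abs] at h3 ⊢
  exact (h _ _ h2 h1 h3.le).trans_lt (half_lt_self hε)

lemma UniformContinuousAtInfinity.tendsto_birkhoffAverage_sub {F : ℝ → ℝ}
    (hF : UniformContinuousAtInfinity F) {k : ℕ} (hk : 0 < k) :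
    Tendsto (fun x => birkhoffAverage ℝ boole F k x - F x) (cocompact ℝ) (𝓝 0) := by
  have h := (tendsto_finsetSum (Finset.range k) fun j _ =>
    hF.tendsto_comp_sub (tendsto_boole_iterate_sub_self j)).const_mul ((k : ℝ)⁻¹)
  rw [Finset.sum_const_zero, mul_zero] at h
  refine h.congr fun x => ?_
  have : (k : ℝ) ≠ 0 := by positivity
  simp only [birkhoffAverage, birkhoffSum, Finset.sum_sub_distrib, Finset.sum_const,
    Finset.card_range, nsmul_eq_mul, smul_eq_mul, mul_sub]
  rw [inv_mul_cancel_left₀ this]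

lemma measurable_birkhoffAverage_boole {F : ℝ → ℝ} (hF : Measurable F) (k : ℕ) :
    Measurable (birkhoffAverage ℝ boole F k) := by
  unfold birkhoffAverage birkhoffSum
  have h := Finset.measurable_fun_sum (Finset.range k) fun j _ =>
    hF.comp (measurable_boole_iterate j)
  exact h.const_smul ((k : ℝ)⁻¹)

/-! ### Change of measure and diagonal sequences. -/

lemma tendstoInMeasure_of_absolutelyContinuous {α ι : Type*} [MeasurableSpace α]
    {μ ν : Measure α} [SigmaFinite μ] [IsFiniteMeasure ν] (hν : ν ≪ μ) {f : ι → α → ℝ}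
    {g : α → ℝ} {l : Filter ι} (h : TendstoInMeasure μ f l g) : TendstoInMeasure ν f l g := by
  intro ε hε
  have h1 := tendsto_setLIntegral_zero (Measure.lintegral_rnDeriv_lt_top ν μ).ne
    (s := fun i => {x | ε ≤ edist (f i x) (g x)}) (h ε hε)
  simpa only [Measure.setLIntegral_rnDeriv hν] using h1

/-- If a diagonal sequence of null sequences is traversed slowly enough, it is still null. -/
lemma exists_tendsto_atTop_diagonal {P : ℕ → ℕ → Prop} (hP : ∀ k, ∀ᶠ n in atTop, P k n) :
    ∃ k : ℕ → ℕ, Tendsto k atTop atTop ∧ ∀ᶠ n in atTop, P (k n) n := by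
  choose N hN using fun k => eventually_atTop.1 (hP k)
  classical
  -- `k n` is the largest `k ≤ n` with `N k ≤ n`; no monotonicity of `N` is needed. The default
  -- value `0` of `Nat.findGreatest` is harmless, since only `n ≥ N 0` matter.
  have key : ∀ K n, max K (N K) ≤ n → K ≤ Nat.findGreatest (fun k => N k ≤ n) n ∧
      N (Nat.findGreatest (fun k => N k ≤ n) n) ≤ n := fun K n hn =>
    ⟨Nat.le_findGreatest (le_of_max_le_left hn) (le_of_max_le_right hn),
      Nat.findGreatest_spec (P := fun k => N k ≤ n) (le_of_max_le_left hn)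
        (le_of_max_le_right hn)⟩
  refine ⟨fun n => Nat.findGreatest (fun k => N k ≤ n) n, tendsto_atTop.2 fun K => ?_, ?_⟩
  · filter_upwards [eventually_ge_atTop (max K (N K))] with n hn using (key K n hn).1
  · filter_upwards [eventually_ge_atTop (max 0 (N 0))] with n hn using hN _ _ (key 0 n hn).2

lemma exists_diagonal_tendstoInMeasure {α : Type*} [MeasurableSpace α] {μ : Measure α}
    {D : ℕ → ℕ → α → ℝ} (hD : ∀ k, TendstoInMeasure μ (D k) atTop 0) :
    ∃ k : ℕ → ℕ, Tendsto k atTop atTop ∧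
      TendstoInMeasure μ (fun n => D (k n) n) atTop 0 := by
  -- One tolerance `1/(k+1)` bounds both the deviation and its measure, so a single predicate per
  -- `k` encodes convergence in measure.
  have hP : ∀ k : ℕ, ∀ᶠ n in atTop, μ {x | ((k : ENNReal) + 1)⁻¹ ≤ edist (D k n x) 0} ≤
      ((k : ENNReal) + 1)⁻¹ := fun k => by
    have hpos : 0 < ((k : ENNReal) + 1)⁻¹ := ENNReal.inv_pos.2 (by simp)
    exact (hD k _ hpos).eventually_le_const hpos
  obtain ⟨k, hk, hk'⟩ := exists_tendsto_atTop_diagonal hP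
  have hinv : Tendsto (fun n => ((k n : ENNReal) + 1)⁻¹) atTop (𝓝 0) := by
    have h := ENNReal.tendsto_inv_nat_nhds_zero.comp ((tendsto_add_atTop_nat 1).comp hk)
    refine h.congr fun n => ?_
    simp
  refine ⟨k, hk, fun ε hε => ?_⟩
  refine tendsto_of_tendsto_of_tendsto_of_le_of_le' tendsto_const_nhds hinv
    (.of_forall fun _ => bot_le) ?_
  filter_upwards [hk', hinv.eventually_le_const hε] with n h1 h2
  exact (measure_mono fun x hx => h2.trans hx).trans h1

/-! ### Characteristic functions and the limit law. -/

lemma measurable_expObs {F : ℝ → ℝ} (hF : Measurable F) (θ : ℝ) : Measurable (expObs F θ) := by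
  unfold expObs; fun_prop

lemma norm_expObs_le (F : ℝ → ℝ) (θ x : ℝ) : ‖expObs F θ x‖ ≤ 1 := by
  unfold expObs
  rw [show Complex.I * θ * F x = ((θ * F x : ℝ) : ℂ) * Complex.I by push_cast; ring,
    Complex.norm_exp_ofReal_mul_I]

lemma charFun_map_comp_boole_iterate {F : ℝ → ℝ} (hF : Measurable F) (ν : Measure ℝ) (n : ℕ)
    (θ : ℝ) :
    charFun (ν.map fun x => F (boole^[n] x)) θ = ∫ x, expObs F θ (boole^[n] x) ∂ν := by
  rw [charFun_apply_real, integral_map (φ := fun x => F (boole^[n] x))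
    (hF.comp (measurable_boole_iterate n)).aemeasurable (by fun_prop)]
  refine integral_congr_ae (.of_forall fun x => ?_)
  simp only [expObs]
  ring_nf

lemma HasAvg.tendsto_charFun_map {F : ℝ → ℝ} (hF : Measurable F) {θ : ℝ} {L : ℂ}
    (hL : HasAvg (expObs F θ) L) (ν : Measure ℝ) [IsProbabilityMeasure ν] (hν : ν ≪ volume) :
    Tendsto (fun n => charFun (ν.map fun x => F (boole^[n] x)) θ) atTop (𝓝 L) := by
  simp only [charFun_map_comp_boole_iterate hF]
  exact hL.tendsto_integral_comp_boole_iterate (measurable_expObs hF θ) (norm_expObs_le F θ) ν hν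

lemma tendstoInDistribution_comp_boole_iterate {F : ℝ → ℝ} (hF : Measurable F) {Ω : Type*}
    [MeasurableSpace Ω] (P : Measure Ω) [IsProbabilityMeasure P] {X : Ω → ℝ} (hX : Measurable X)
    (hav : ∀ θ : ℝ, HasAvg (expObs F θ) (charFun (P.map X) θ)) (ν : Measure ℝ)
    [IsProbabilityMeasure ν] (hν : ν ≪ volume) :
    TendstoInDistribution (fun n x => F (boole^[n] x)) atTop X (fun _ => ν) P where
  forall_aemeasurable n := (hF.comp (measurable_boole_iterate n)).aemeasurable
  aemeasurable_limit := hX.aemeasurable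
  tendsto := ProbabilityMeasure.tendsto_of_tendsto_charFun fun θ =>
    (hav θ).tendsto_charFun_map hF ν hν

lemma tendstoInDistribution_birkhoffAverage {F : ℝ → ℝ} (hF : Measurable F) {Ω : Type*}
    [MeasurableSpace Ω] (P : Measure Ω) [IsProbabilityMeasure P] {X : Ω → ℝ} (hX : Measurable X)
    (hav : ∀ θ : ℝ, HasAvg (expObs F θ) (charFun (P.map X) θ)) (ν : Measure ℝ)
    [IsProbabilityMeasure ν] (hν : ν ≪ volume) {k : ℕ → ℕ}
    (hk : TendstoInMeasure ν
      (fun n x => birkhoffAverage ℝ boole F (k n) (boole^[n] x) - F (boole^[n] x)) atTop 0) :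
    TendstoInDistribution (fun n x => birkhoffAverage ℝ boole F (k n) (boole^[n] x)) atTop X
      (fun _ => ν) P :=
  tendstoInDistribution_of_tendstoInMeasure_sub _ X
    (tendstoInDistribution_comp_boole_iterate hF P hX hav ν hν) hk fun n =>
    ((measurable_birkhoffAverage_boole hF (k n)).comp (measurable_boole_iterate n)).aemeasurable

/-- A sequence of probability measures on a common compact set whose characteristic functions
converge pointwise has a limit law. -/
lemma exists_charFun_eq_of_tendsto {μ : ℕ → ProbabilityMeasure ℝ} {K : Set ℝ} (hK : IsCompact K)
    (hμ : ∀ n, (μ n : Measure ℝ) Kᶜ = 0) {φ : ℝ → ℂ}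
    (hφ : ∀ θ, Tendsto (fun n => charFun (μ n : Measure ℝ) θ) atTop (𝓝 (φ θ))) :
    ∃ μ₀ : ProbabilityMeasure ℝ, ∀ θ, charFun (μ₀ : Measure ℝ) θ = φ θ := by
  have htight : IsTightMeasureSet {((ρ : ProbabilityMeasure ℝ) : Measure ℝ) | ρ ∈ Set.range μ} := by
    refine isTightMeasureSet_iff_exists_isCompact_measure_compl_le.2 fun ε _ => ⟨K, hK, ?_⟩
    rintro _ ⟨_, ⟨n, rfl⟩, rfl⟩
    simp [hμ n]
  obtain ⟨μ₀, -, s, hs, hlim⟩ := (isCompact_closure_of_isTightMeasureSet htight).tendsto_subseq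
    fun n => subset_closure (Set.mem_range_self n)
  exact ⟨μ₀, fun θ => tendsto_nhds_unique
    (ProbabilityMeasure.tendsto_iff_tendsto_charFun.1 hlim θ) ((hφ θ).comp hs.tendsto_atTop)⟩

/-- The limit law arises dynamically, from the laws of `F ∘ T^n` under one fixed probability measure
equivalent to `m`. All of them live on `[-C, C]`. -/
lemma exists_probabilityMeasure_hasAvg_charFun {F : ℝ → ℝ} (hF : Measurable F)
    (havg : ∀ θ : ℝ, ∃ L : ℂ, HasAvg (expObs F θ) L) (hbdd : ∃ C : ℝ, ∀ x : ℝ, |F x| ≤ C) :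
    ∃ μ : Measure ℝ, IsProbabilityMeasure μ ∧ ∀ θ : ℝ, HasAvg (expObs F θ) (charFun μ θ) := by
  choose φ hφ using havg
  obtain ⟨C, hC⟩ := hbdd
  let ν : Measure ℝ := (volume : Measure ℝ).toFinite
  have hm : ∀ n, Measurable fun x => F (boole^[n] x) := fun n =>
    hF.comp (measurable_boole_iterate n)
  have hsupp : ∀ n, (ν.map fun x => F (boole^[n] x)) (Set.Icc (-C) C)ᶜ = 0 := fun n => by
    rw [Measure.map_apply (hm n) measurableSet_Icc.compl]
    convert! measure_empty (μ := ν)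
    ext x
    simpa using abs_le.1 (hC (boole^[n] x))
  obtain ⟨μ₀, h⟩ := exists_charFun_eq_of_tendsto
    (μ := fun n => ⟨ν.map fun x => F (boole^[n] x),
      Measure.isProbabilityMeasure_map (hm n).aemeasurable⟩) isCompact_Icc hsupp fun θ =>
      (hφ θ).tendsto_charFun_map hF ν (toFinite_absolutelyContinuous _)
  exact ⟨μ₀, inferInstance, fun θ => by rw [h]; exact hφ θ⟩

end BooleMap

theorem proposition3p3
    (F : ℝ → ℝ) (hF : Measurable F)
    (havg : ∀ θ : ℝ, ∃ L : ℂ, BooleMap.HasAvg (BooleMap.expObs F θ) L)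
    (hbdd : ∃ C : ℝ, ∀ x : ℝ, |F x| ≤ C)
    (huc : BooleMap.UniformContinuousAtInfinity F) :
    -- a random variable with characteristic function `θ ↦ avg (e^{iθF})` exists
    (∃ μ : Measure ℝ, IsProbabilityMeasure μ ∧
      ∀ θ : ℝ, BooleMap.HasAvg (BooleMap.expObs F θ) (charFun μ θ)) ∧
    -- and for every such random variable `X` both limit statements hold
    ∀ (Ω : Type*) [MeasurableSpace Ω] (P : Measure Ω) [IsProbabilityMeasure P] (X : Ω → ℝ),
      Measurable X →
      (∀ θ : ℝ, BooleMap.HasAvg (BooleMap.expObs F θ) (charFun (P.map X) θ)) →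
      (∀ k : ℕ, 0 < k →
        BooleMap.TendstoStrongDistribution
          (fun n x => birkhoffAverage ℝ BooleMap.boole F k (BooleMap.boole^[n] x)) X P) ∧
      (∃ k : ℕ → ℕ, (∀ n, 0 < k n) ∧ Tendsto k atTop atTop ∧
        BooleMap.TendstoStrongDistribution
          (fun n x => birkhoffAverage ℝ BooleMap.boole F (k n) (BooleMap.boole^[n] x)) X P) := by
  refine ⟨BooleMap.exists_probabilityMeasure_hasAvg_charFun hF havg hbdd, ?_⟩
  intro Ω _ P _ X hX hav
  refine ⟨fun k hk ν _ hν => ?_, ?_⟩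
  · exact BooleMap.tendstoInDistribution_birkhoffAverage hF P hX hav ν hν (k := fun _ => k)
      (BooleMap.tendstoInMeasure_comp_boole_iterate (huc.tendsto_birkhoffAverage_sub hk) ν hν)
  -- The sequence must not depend on `ν`, so it is built for a probability measure equivalent to
  -- `m`.
  · have hac : volume ≪ (volume : Measure ℝ).toFinite := absolutelyContinuous_toFinite _
    obtain ⟨k, hk, hk'⟩ := BooleMap.exists_diagonal_tendstoInMeasure
      (μ := (volume : Measure ℝ).toFinite) fun k =>
        BooleMap.tendstoInMeasure_comp_boole_iterate
          (huc.tendsto_birkhoffAverage_sub k.succ_pos) _ (toFinite_absolutelyContinuous _)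
    -- The diagonal was run over averages of length `k + 1`, which keeps every length positive.
    refine ⟨fun n => k n + 1, fun n => Nat.succ_pos _, (tendsto_add_atTop_nat 1).comp hk, ?_⟩
    intro ν _ hν
    exact BooleMap.tendstoInDistribution_birkhoffAverage hF P hX hav ν hν
      (BooleMap.tendstoInMeasure_of_absolutelyContinuous (hν.trans hac) hk')
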